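/- Let $\ell\ge 0$ and let $M$ be a compact smooth manifold (without boundary) of dimension $4\ell+2$ (orientability is not needed). Let $\Omega:=\Omega^{2\ell+1}_{\rm closed}(M)$ be the space of smooth closed real $(2\ell+1)$-forms, $\Omega_{\mathbb Z}\subset\Omega$ the subgroup of forms whose integral over every integral smooth singular cycle is an integer, and $\mathcal M$ the space of smooth Riemannian metrics on $M$, where $\Omega$ and $\mathcal M$ carry the $C^\infty$ topology. Put $\mathcal B=\Omega\times\mathcal M$. Let $\mathcal G_{\rm diff}$ be any subgroup of ${\rm Diff}(M)$, and let the group $\mathcal G$ of pairs $(B,\phi)$ with $B\in\Omega_{\mathbb Z}$, $\phi\in\mathcal G_{\rm diff}$ act on $\mathcal B$ by $(B,\phi)\cdot(A,g)=(\phi^*A+B,\phi^*g)$. (The full group of gauge transformations acts on $\mathcal B$ through its projection onto $\Omega_{\mathbb Z}$, so it has the same orbits.) Let $\pi:\mathcal B\to\mathcal F=\mathcal B/\mathcal G$ be the projection onto the quotient space. As $\mathcal F$ is in general singular, a loop in $\mathcal F$ means a continuous map $c:[0,1]\to\mathcal F$ with $c(0)=c(1)$ that lifts locally, i.e. near each parameter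 value $c$ is the image under $\pi$ of a continuous family in $\mathcal B$. A loop is *horizontal* if it is the projection of a path $t\mapsto\big(t\,\phi^*A+(1-t)A,\;p_2(t)\big)$ with $A\in\Omega$, $\phi\in\mathcal G_{\rm diff}$ and $p_2$ a continuous path in $\mathcal M$ with $p_2(1)=\phi^*p_2(0)$. A loop is *vertical* if it is the projection of a path $t\mapsto(p_1(t),g)$ with constant metric $g$, $p_1$ continuous in $\Omega$ and $p_1(1)=p_1(0)+B$ for some $B\in\Omega_{\mathbb Z}$. **Proposition.** Every loop $c$ in $\mathcal F$ is homotopic, with fixed base point, to the composition of a horizontal loop followed by a vertical loop. More precisely, $c$ has a continuous lift $p=(p_1,p_2):[0,1]\to\mathcal B$ with $p(1)=(B,\phi)\cdot p(0)$ for some $(B,\phi)\in\mathcal G$; and for every such lift and every such $(B,\phi)$, the map $$p_S(s,t)=\Big((1-\rho)\big(s\,\phi^*p_1(0)+(1-s)p_1(0)+tB\big)+\rho\,p_1(s),\;p_2(s)\Big),\qquad \rho(s,t)=\frac{\log s}{\log t},$$ on $S=\{(s,t)\in[0,1]^2: s\ge t\}$ (with $\rho:=0$ where $t\in\{0,1\}$)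 is continuous into $\mathcal B$ and satisfies $p_S(t,t)=p(t)$, $p_S(s,0)=\big(s\,\phi^*p_1(0)+(1-s)p_1(0),\,p_2(s)\big)$ and $p_S(1,t)=\big(\phi^*p_1(0)+tB,\,p_2(1)\big)$. The projections $c_h(s)=\pi(p_S(s,0))$ and $c_v(t)=\pi(p_S(1,t))$ are respectively a horizontal and a vertical loop, and there is a homotopy with fixed base point from $c$ to the composition of $c_h$ followed by $c_v$ that lifts to a continuous map $[0,1]^2\to\mathcal B$ starting at $p$. -/

import Mathlib

open scoped Manifold ContDiff Topology
open Set MeasureTheory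

set_option linter.unusedSectionVars false

noncomputable section

namespace BackgroundFields

/-! ### Manifolds, charts and diffeomorphisms -/

/-- The model space `ℝⁿ`. -/
abbrev Model (n : ℕ) : Type := EuclideanSpace ℝ (Fin n)

/-- The tangent space at a point of a manifold modelled on `ℝⁿ`. -/
abbrev TSpace (n : ℕ) {M : Type*} [TopologicalSpace M] [ChartedSpace (Model n) M] (x : M) : Type :=
  TangentSpace 𝓘(ℝ, Model n) x

/-- The smooth diffeomorphisms of `M`. -/
abbrev Diff (n : ℕ) (M : Type*) [TopologicalSpace M] [ChartedSpace (Model n) M] : Type _ :=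
  M ≃ₘ⟮𝓘(ℝ, Model n), 𝓘(ℝ, Model n)⟯ M

section Manifold

variable {n : ℕ} {M : Type*} [TopologicalSpace M] [ChartedSpace (Model n) M]

/-- `Diff(M)` is a group under composition: `(φ * ψ) x = φ (ψ x)`. -/
instance diffGroup : Group (Diff n M) where
  mul φ ψ := Diffeomorph.trans ψ φ
  one := Diffeomorph.refl _ M _
  inv φ := φ.symm
  mul_assoc _ _ _ := rfl
  one_mul _ := rfl
  mul_one _ := rfl
  inv_mul_cancel φ := Diffeomorph.self_trans_symm φ

/-- The charts of `M`: the elements of the maximal smooth atlas. -/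
def IsSmoothChart (e : OpenPartialHomeomorph M (Model n)) : Prop :=
  e ∈ IsManifold.maximalAtlas 𝓘(ℝ, Model n) ∞ M

/-- The `C^∞` topology (uniform convergence of all derivatives on compact subsets of all charts)
on a type `X` of tensor fields, where `rep e x` is the coordinate expression in the chart `e` of
the field `x`. -/
abbrev cInftyTopology {X W : Type*} [NormedAddCommGroup W] [NormedSpace ℝ W]
    (rep : OpenPartialHomeomorph M (Model n) → X → Model n → W) : TopologicalSpace X :=
  ⨅ (e : OpenPartialHomeomorph M (Model n)) (_ : IsSmoothChart e)
    (K : Set (Model n)) (_ : IsCompact K ∧ K ⊆ e.target) (r : ℕ),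
    TopologicalSpace.induced
      (fun x => UniformFun.ofFun fun y : K => iteratedFDeriv ℝ r (rep e x) (y : Model n))
      inferInstance

end Manifold

/-! ### Closed differential forms -/

section Forms

variable {n : ℕ} {k : ℕ} {M : Type*} [TopologicalSpace M] [ChartedSpace (Model n) M]

/-- Fields of alternating `k`-forms, without regularity. -/
abbrev RawForm (n k : ℕ) (M : Type*) [TopologicalSpace M] [ChartedSpace (Model n) M] : Type _ :=
  ∀ x : M, TSpace n x [⋀^Fin k]→L[ℝ] ℝ

/-- The coordinate expression `(e⁻¹)^* α` of a form in a chart `e`. -/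
def formInChart (e : OpenPartialHomeomorph M (Model n)) (α : RawForm n k M) :
    Model n → Model n [⋀^Fin k]→L[ℝ] ℝ :=
  fun y => (α (e.symm y)).compContinuousLinearMap
    (mfderiv 𝓘(ℝ, Model n) 𝓘(ℝ, Model n) e.symm y)

/-- The pullback `φ^* α`. -/
def RawForm.pullback (φ : M → M) (α : RawForm n k M) : RawForm n k M :=
  fun x => (α (φ x)).compContinuousLinearMap (mfderiv 𝓘(ℝ, Model n) 𝓘(ℝ, Model n) φ x)

variable (n k M) in
/-- The smooth closed `k`-forms, as a subspace of all fields of alternating forms: in every chart,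
the coordinate expression is smooth and its exterior derivative vanishes. -/
def closedForms : Submodule ℝ (RawForm n k M) where
  carrier := {α | ∀ e : OpenPartialHomeomorph M (Model n), IsSmoothChart e →
    ContDiffOn ℝ ∞ (formInChart e α) e.target ∧ ∀ y ∈ e.target, extDeriv (formInChart e α) y = 0}
  zero_mem' e _ := by
    have h : formInChart e (0 : RawForm n k M) = 0 := by
      ext y v; rfl
    rw [h]
    refine ⟨contDiffOn_const, fun y _ => ?_⟩
    have := extDeriv_smul (𝕜 := ℝ) (x := y) 0 (0 : Model n → Model n [⋀^Fin k]→L[ℝ] ℝ)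
    simpa using this
  add_mem' {α β} hα hβ e he := by
    have h : formInChart e (α + β) = formInChart e α + formInChart e β := by
      ext y v; rfl
    rw [h]
    refine ⟨(hα e he).1.add (hβ e he).1, fun y hy => ?_⟩
    have d1 := ((hα e he).1.contDiffAt (e.open_target.mem_nhds hy)).differentiableAt (by simp)
    have d2 := ((hβ e he).1.contDiffAt (e.open_target.mem_nhds hy)).differentiableAt (by simp)
    rw [extDeriv_add d1 d2, (hα e he).2 y hy, (hβ e he).2 y hy, add_zero]
  smul_mem' c α hα e he := by
    have h : formInChart e (c • α) = c • formInChart e α := by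
      ext y v; rfl
    rw [h]
    refine ⟨(hα e he).1.const_smul c, fun y hy => ?_⟩
    rw [extDeriv_smul, (hα e he).2 y hy, smul_zero]

variable (n k M) in
/-- `Ω^k_closed(M)`, the real vector space of smooth closed `k`-forms on `M`, with the
`C^∞` topology (the type synonym discards the topology of pointwise convergence). -/
def ClosedForm : Type _ := closedForms n k M

instance : AddCommGroup (ClosedForm n k M) := inferInstanceAs (AddCommGroup (closedForms n k M))
instance : Module ℝ (ClosedForm n k M) := inferInstanceAs (Module ℝ (closedForms n k M))

/-- The underlying field of alternating forms. -/
def ClosedForm.val (α : ClosedForm n k M) : RawForm n k M := Subtype.val α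

instance : TopologicalSpace (ClosedForm n k M) :=
  cInftyTopology fun e (α : ClosedForm n k M) => formInChart e α.val

@[ext] theorem ClosedForm.ext {α β : ClosedForm n k M} (h : α.val = β.val) : α = β :=
  Subtype.ext h

/-- The chart `e ∘ φ⁻¹`. -/
def pushChart (φ : Diff n M) (e : OpenPartialHomeomorph M (Model n)) :
    OpenPartialHomeomorph M (Model n) :=
  φ.symm.toHomeomorph.toOpenPartialHomeomorph.trans e

theorem isSmoothChart_pushChart [IsManifold 𝓘(ℝ, Model n) ∞ M] (φ : Diff n M)
    {e : OpenPartialHomeomorph M (Model n)} (he : IsSmoothChart e) :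
    IsSmoothChart (pushChart φ e) := by
  unfold IsSmoothChart at *
  rw [IsManifold.mem_maximalAtlas_iff_contMDiffOn] at he ⊢
  constructor
  · refine he.1.comp (φ.symm.contMDiff.contMDiffOn) ?_
    intro x hx
    simpa [pushChart] using hx
  · have h : (pushChart φ e).target = e.target := by simp [pushChart]
    rw [h]
    exact φ.contMDiff.comp_contMDiffOn he.2

theorem pushChart_target (φ : Diff n M) (e : OpenPartialHomeomorph M (Model n)) :
    (pushChart φ e).target = e.target := by simp [pushChart]

theorem pushChart_symm_apply (φ : Diff n M) (e : OpenPartialHomeomorph M (Model n)) :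
    ⇑(pushChart φ e).symm = φ ∘ e.symm := rfl

theorem mfderiv_pushChart_symm [IsManifold 𝓘(ℝ, Model n) ∞ M] (φ : Diff n M)
    {e : OpenPartialHomeomorph M (Model n)} (he : IsSmoothChart e) {y : Model n}
    (hy : y ∈ e.target) :
    mfderiv 𝓘(ℝ, Model n) 𝓘(ℝ, Model n) (φ ∘ e.symm) y =
      (mfderiv 𝓘(ℝ, Model n) 𝓘(ℝ, Model n) φ (e.symm y)).comp
        (mfderiv 𝓘(ℝ, Model n) 𝓘(ℝ, Model n) e.symm y) :=
  mfderiv_comp y (φ.mdifferentiable (by simp) _)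
    ((contMDiffAt_symm_of_mem_maximalAtlas he hy).mdifferentiableAt (by simp))

theorem formInChart_pullback [IsManifold 𝓘(ℝ, Model n) ∞ M] (φ : Diff n M)
    {e : OpenPartialHomeomorph M (Model n)} (he : IsSmoothChart e) (α : RawForm n k M)
    {y : Model n} (hy : y ∈ e.target) :
    formInChart e (α.pullback φ) y = formInChart (pushChart φ e) α y := by
  ext v
  simp only [formInChart, RawForm.pullback, pushChart_symm_apply, mfderiv_pushChart_symm φ he hy]
  rfl

/-- The pullback `φ^* α` of a closed form along a diffeomorphism. -/
def ClosedForm.pullback [IsManifold 𝓘(ℝ, Model n) ∞ M] (φ : Diff n M) (α : ClosedForm n k M) :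
    ClosedForm n k M :=
  ⟨α.val.pullback φ, fun e he => by
    have h := α.property (pushChart φ e) (isSmoothChart_pushChart φ he)
    rw [pushChart_target] at h
    refine ⟨h.1.congr fun y hy => formInChart_pullback φ he _ hy, fun y hy => ?_⟩
    rw [← h.2 y hy]
    have : formInChart e (α.val.pullback φ) =ᶠ[𝓝 y] formInChart (pushChart φ e) α.val := by
      filter_upwards [e.open_target.mem_nhds hy] with z hz
      exact formInChart_pullback φ he _ hz
    unfold extDeriv
    rw [this.fderiv_eq]
    rfl⟩

variable [IsManifold 𝓘(ℝ, Model n) ∞ M]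

theorem ClosedForm.pullback_add (φ : Diff n M) (α β : ClosedForm n k M) :
    (α + β).pullback φ = α.pullback φ + β.pullback φ := by
  apply ClosedForm.ext; rfl

theorem ClosedForm.pullback_one (α : ClosedForm n k M) : α.pullback (1 : Diff n M) = α := by
  apply ClosedForm.ext
  funext x
  change (α.val x).compContinuousLinearMap (mfderiv 𝓘(ℝ, Model n) 𝓘(ℝ, Model n) id x) = _
  rw [mfderiv_id]
  rfl

theorem mfderiv_mul (φ ψ : Diff n M) (x : M) :
    mfderiv 𝓘(ℝ, Model n) 𝓘(ℝ, Model n) (φ * ψ : Diff n M) x =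
      (mfderiv 𝓘(ℝ, Model n) 𝓘(ℝ, Model n) φ (ψ x)).comp
        (mfderiv 𝓘(ℝ, Model n) 𝓘(ℝ, Model n) ψ x) :=
  mfderiv_comp x (φ.mdifferentiable (by simp) _) (ψ.mdifferentiable (by simp) _)

theorem ClosedForm.pullback_mul (φ ψ : Diff n M) (α : ClosedForm n k M) :
    α.pullback (φ * ψ) = (α.pullback φ).pullback ψ := by
  apply ClosedForm.ext
  funext x
  change (α.val (φ (ψ x))).compContinuousLinearMap
    (mfderiv 𝓘(ℝ, Model n) 𝓘(ℝ, Model n) (φ * ψ : Diff n M) x) = _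
  rw [mfderiv_mul]
  rfl

end Forms

/-! ### Riemannian metrics -/

section Metrics

variable {n : ℕ} {M : Type*} [TopologicalSpace M] [ChartedSpace (Model n) M]
  [IsManifold 𝓘(ℝ, Model n) ∞ M]

variable (n M) in
/-- The space `𝓜` of smooth Riemannian metrics on `M`. -/
abbrev Metric : Type _ :=
  Bundle.ContMDiffRiemannianMetric 𝓘(ℝ, Model n) ∞ (Model n) (fun x : M => TSpace n x)

/-- The coordinate expression of a metric in a chart `e`. -/
def metricInChart (e : OpenPartialHomeomorph M (Model n)) (g : Metric n M) :
    Model n → Model n →L[ℝ] Model n →L[ℝ] ℝ :=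
  fun y =>
    let D : TSpace n y →L[ℝ] TSpace n (e.symm y) :=
      mfderiv 𝓘(ℝ, Model n) 𝓘(ℝ, Model n) e.symm y
    (D.precomp ℝ).comp ((g.inner (e.symm y)).comp D)

instance : TopologicalSpace (Metric n M) := cInftyTopology metricInChart

theorem mfderiv_injective (φ : Diff n M) (x : M) :
    Function.Injective (mfderiv 𝓘(ℝ, Model n) 𝓘(ℝ, Model n) φ x) := by
  rw [← φ.mfderivToContinuousLinearEquiv_coe (by simp)]
  exact (φ.mfderivToContinuousLinearEquiv (by simp) (x := x)).injective

/-- The trivialization of the tangent bundle around `x₀`. -/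
abbrev triv (n : ℕ) (M : Type*) [TopologicalSpace M] [ChartedSpace (Model n) M]
    [IsManifold 𝓘(ℝ, Model n) ∞ M] (x₀ : M) :=
  trivializationAt (Model n) (fun x : M => TSpace n x) x₀

/-- The differential of `φ` in the trivializations around `x₀` and `φ x₀`. -/
abbrev derivInTriv (φ : Diff n M) (x₀ x : M) : Model n →L[ℝ] Model n :=
  inTangentCoordinates 𝓘(ℝ, Model n) 𝓘(ℝ, Model n) id φ
    (mfderiv 𝓘(ℝ, Model n) 𝓘(ℝ, Model n) φ) x₀ x

theorem triv_symm_deriv (φ : Diff n M) {x₀ x : M} (hx : x ∈ (triv n M x₀).baseSet)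
    (hx' : φ x ∈ (triv n M (φ x₀)).baseSet) (v : Model n) :
    (triv n M (φ x₀)).symm (φ x) (derivInTriv φ x₀ x v) =
      mfderiv 𝓘(ℝ, Model n) 𝓘(ℝ, Model n) φ x ((triv n M x₀).symm x v) := by
  have h : derivInTriv φ x₀ x = _ :=
    ContinuousLinearMap.inCoordinates_eq (ϕ := mfderiv 𝓘(ℝ, Model n) 𝓘(ℝ, Model n) φ x) hx hx'
  rw [h]
  exact Bundle.Trivialization.symm_apply_apply_mk _ hx' _

theorem metric_coords (φ : Diff n M) (g : Metric n M) {x₀ x : M}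
    (hx : x ∈ (triv n M x₀).baseSet)
    (hx' : φ x ∈ (triv n M (φ x₀)).baseSet) :
    ContinuousLinearMap.inCoordinates (Model n) (fun x : M => TSpace n x) (Model n →L[ℝ] ℝ)
      (fun x : M => TSpace n x →L[ℝ] ℝ) x₀ x x₀ x
      (((mfderiv 𝓘(ℝ, Model n) 𝓘(ℝ, Model n) φ x).precomp ℝ).comp ((g.inner (φ x)).comp
        (mfderiv 𝓘(ℝ, Model n) 𝓘(ℝ, Model n) φ x))) =
    ((derivInTriv φ x₀ x).precomp ℝ).comp
      ((ContinuousLinearMap.inCoordinates (Model n) (fun x : M => TSpace n x) (Model n →L[ℝ] ℝ)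
      (fun x : M => TSpace n x →L[ℝ] ℝ) (φ x₀) (φ x) (φ x₀) (φ x) (g.inner (φ x))).comp
      (derivInTriv φ x₀ x)) := by
  ext v w
  have e1 := inCoordinates_apply_eq₂ (𝕜 := ℝ) (F₁ := Model n)
    (E₁ := fun x : M => TSpace n x) (F₂ := Model n) (E₂ := fun x : M => TSpace n x) (F₃ := ℝ)
    (E₃ := Bundle.Trivial M ℝ) (x₀ := x₀) (x := x)
    (ϕ := ((mfderiv 𝓘(ℝ, Model n) 𝓘(ℝ, Model n) φ x).precomp ℝ).comp ((g.inner (φ x)).comp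
      (mfderiv 𝓘(ℝ, Model n) 𝓘(ℝ, Model n) φ x))) (v := v) (w := w)
    hx hx (mem_univ _)
  have e2 := inCoordinates_apply_eq₂ (𝕜 := ℝ) (F₁ := Model n)
    (E₁ := fun x : M => TSpace n x) (F₂ := Model n) (E₂ := fun x : M => TSpace n x) (F₃ := ℝ)
    (E₃ := Bundle.Trivial M ℝ) (x₀ := φ x₀) (x := φ x)
    (ϕ := g.inner (φ x)) (v := derivInTriv φ x₀ x v) (w := derivInTriv φ x₀ x w)
    hx' hx' (mem_univ _)
  rw [triv_symm_deriv φ hx hx', triv_symm_deriv φ hx hx'] at e2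
  exact e1.trans e2.symm

/-- The pullback of a smooth metric is smooth. -/
theorem contMDiff_pullback (φ : Diff n M) (g : Metric n M) :
    ContMDiff 𝓘(ℝ, Model n) (𝓘(ℝ, Model n).prod 𝓘(ℝ, Model n →L[ℝ] Model n →L[ℝ] ℝ)) ∞
      (fun x : M => Bundle.TotalSpace.mk' (Model n →L[ℝ] Model n →L[ℝ] ℝ)
        (E := fun x : M => TSpace n x →L[ℝ] TSpace n x →L[ℝ] ℝ) x
      (((mfderiv 𝓘(ℝ, Model n) 𝓘(ℝ, Model n) φ x).precomp ℝ).comp ((g.inner (φ x)).comp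
        (mfderiv 𝓘(ℝ, Model n) 𝓘(ℝ, Model n) φ x)))) := by
  intro x₀
  rw [contMDiffAt_hom_bundle]
  refine ⟨contMDiffAt_id, ?_⟩
  have hg := ((contMDiffAt_hom_bundle _).1 (g.contMDiff (φ x₀))).2
  have hg' := hg.comp x₀ φ.contMDiff.contMDiffAt
  have hD : ContMDiffAt 𝓘(ℝ, Model n) 𝓘(ℝ, Model n →L[ℝ] Model n) ∞ (derivInTriv φ x₀) x₀ :=
    (φ.contMDiff.contMDiffAt (x := x₀)).mfderiv_const (m := ∞) (by simp)
  have key := (hD.clm_precomp (F₃ := ℝ)).clm_comp (hg'.clm_comp hD)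
  refine key.congr_of_eventuallyEq ?_
  have h1 : ∀ᶠ x in 𝓝 x₀, x ∈ (triv n M x₀).baseSet :=
    (triv n M x₀).open_baseSet.mem_nhds (FiberBundle.mem_baseSet_trivializationAt' x₀)
  have h2 : ∀ᶠ x in 𝓝 x₀, φ x ∈ (triv n M (φ x₀)).baseSet :=
    φ.continuous.continuousAt.eventually ((triv n M (φ x₀)).open_baseSet.mem_nhds
      (FiberBundle.mem_baseSet_trivializationAt' (φ x₀)))
  filter_upwards [h1, h2] with x hx hx'
  exact metric_coords φ g hx hx'

/-- The pullback `φ^* g`. -/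
def Metric.pullback (φ : Diff n M) (g : Metric n M) : Metric n M where
  inner x :=
    let D : TSpace n x →L[ℝ] TSpace n (φ x) := mfderiv 𝓘(ℝ, Model n) 𝓘(ℝ, Model n) φ x
    (D.precomp ℝ).comp ((g.inner (φ x)).comp D)
  symm x v w := g.symm _ _ _
  pos x v hv := g.pos _ _ fun h => hv (mfderiv_injective φ x (h.trans (map_zero _).symm))
  isVonNBounded x := by
    let L : TSpace n x ≃L[ℝ] TSpace n (φ x) :=
      φ.mfderivToContinuousLinearEquiv (by simp) (x := x)
    have h := (g.isVonNBounded (φ x)).image (L.symm : TSpace n (φ x) →L[ℝ] TSpace n x)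
    refine h.subset ?_
    intro v hv
    exact ⟨L v, hv, L.symm_apply_apply v⟩
  contMDiff := contMDiff_pullback φ g

theorem Metric.ext {g g' : Metric n M} (h : ∀ x, g.inner x = g'.inner x) : g = g' := by
  obtain ⟨i, _, _, _, _⟩ := g
  obtain ⟨i', _, _, _, _⟩ := g'
  obtain rfl : i = i' := funext h
  rfl

theorem Metric.pullback_one (g : Metric n M) : g.pullback (1 : Diff n M) = g := by
  refine Metric.ext fun x => ?_
  ext v w
  change g.inner x (mfderiv 𝓘(ℝ, Model n) 𝓘(ℝ, Model n) id x v)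
    (mfderiv 𝓘(ℝ, Model n) 𝓘(ℝ, Model n) id x w) = _
  rw [mfderiv_id]
  rfl

theorem Metric.pullback_mul (φ ψ : Diff n M) (g : Metric n M) :
    g.pullback (φ * ψ) = (g.pullback φ).pullback ψ := by
  refine Metric.ext fun x => ?_
  ext v w
  change g.inner (φ (ψ x)) (mfderiv 𝓘(ℝ, Model n) 𝓘(ℝ, Model n) (φ * ψ : Diff n M) x v)
    (mfderiv 𝓘(ℝ, Model n) 𝓘(ℝ, Model n) (φ * ψ : Diff n M) x w) = _
  rw [mfderiv_mul]
  rfl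

end Metrics

/-! ### Smooth singular chains and periods -/

section Periods

variable {n : ℕ} {M : Type*} [TopologicalSpace M] [ChartedSpace (Model n) M]

/-- The standard `p`-simplex `{x ∈ ℝᵖ | xᵢ ≥ 0, ∑ xᵢ ≤ 1}`. -/
def simplex (p : ℕ) : Set (Fin p → ℝ) := {x | (∀ i, 0 ≤ x i) ∧ ∑ i, x i ≤ 1}

/-- The interior of the standard `p`-simplex. -/
def openSimplex (p : ℕ) : Set (Fin p → ℝ) := {x | (∀ i, 0 < x i) ∧ ∑ i, x i < 1}

/-- The `i`-th face inclusion: pass to the barycentric coordinates `(1 - ∑ xⱼ, x₀, …, xₚ₋₁)`,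
insert `0` in position `i`, and forget the first barycentric coordinate. -/
def faceMap (p : ℕ) (i : Fin (p + 2)) (x : Fin p → ℝ) : Fin (p + 1) → ℝ :=
  Fin.tail (i.insertNth (α := fun _ => ℝ) 0 (Fin.cons (1 - ∑ j, x j) x))

theorem faceMap_mem (p : ℕ) (i : Fin (p + 2)) {x : Fin p → ℝ} (hx : x ∈ simplex p) :
    faceMap p i x ∈ simplex (p + 1) := by
  set b : Fin (p + 1) → ℝ := Fin.cons (1 - ∑ j, x j) x with hb
  have hb0 : ∀ j, 0 ≤ b j := by
    intro j
    refine Fin.cases ?_ (fun j => ?_) j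
    · simp [hb, hx.2]
    · simpa [hb] using hx.1 j
  have hb1 : ∑ j, b j = 1 := by simp [hb, Fin.sum_univ_succ]
  set c : Fin (p + 2) → ℝ := i.insertNth (α := fun _ => ℝ) 0 b with hc
  have hc0 : ∀ j, 0 ≤ c j := by
    intro j
    refine Fin.succAboveCases i ?_ (fun j => ?_) j
    · simp [hc]
    · simpa [hc] using hb0 j
  have hc1 : ∑ j, c j = 1 := by
    rw [Fin.sum_univ_succAbove c i]; simp [hc, hb1]
  refine ⟨fun j => hc0 j.succ, ?_⟩
  rw [Fin.sum_univ_succ] at hc1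
  have := hc0 0
  change ∑ j : Fin (p + 1), c j.succ ≤ 1
  linarith

theorem contDiff_faceMap (p : ℕ) (i : Fin (p + 2)) : ContDiff ℝ ∞ (faceMap p i) := by
  rw [contDiff_pi]
  intro j
  have h : ∀ m : Fin (p + 2), ContDiff ℝ ∞ fun x : Fin p → ℝ =>
      (i.insertNth (α := fun _ => ℝ) 0 (Fin.cons (1 - ∑ j, x j) x) : Fin (p + 2) → ℝ) m := by
    intro m
    refine Fin.succAboveCases i ?_ (fun m => ?_) m
    · simpa using contDiff_const
    · refine Fin.cases ?_ (fun m => ?_) m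
      · simp only [Fin.insertNth_apply_succAbove, Fin.cons_zero]
        exact contDiff_const.sub (ContDiff.sum fun k _ => contDiff_apply ℝ ℝ k)
      · simp only [Fin.insertNth_apply_succAbove, Fin.cons_succ]
        exact contDiff_apply ℝ ℝ m
  exact h j.succ

/-- Smoothness on a neighbourhood of the standard simplex. -/
def IsSmoothExtension (n : ℕ) {M : Type*} [TopologicalSpace M] [ChartedSpace (Model n) M] {p : ℕ}
    (s : simplex p → M) (f : (Fin p → ℝ) → M) : Prop :=
  (∃ U : Set (Fin p → ℝ), IsOpen U ∧ simplex p ⊆ U ∧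
    ContMDiffOn 𝓘(ℝ, Fin p → ℝ) 𝓘(ℝ, Model n) ∞ f U) ∧ ∀ x : simplex p, f x = s x

variable (n M) in
/-- Smooth singular `p`-simplices of `M`. -/
structure SmoothSimplex (p : ℕ) where
  toFun : simplex p → M
  exists_extension : ∃ f, IsSmoothExtension n toFun f

/-- A smooth extension of a smooth simplex to a neighbourhood of the standard simplex. -/
def SmoothSimplex.extension {p : ℕ} (s : SmoothSimplex n M p) : (Fin p → ℝ) → M :=
  s.exists_extension.choose

/-- The `i`-th face of a smooth simplex. -/
def SmoothSimplex.face {p : ℕ} (s : SmoothSimplex n M (p + 1)) (i : Fin (p + 2)) :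
    SmoothSimplex n M p where
  toFun x := s.toFun ⟨faceMap p i x, faceMap_mem p i x.2⟩
  exists_extension := by
    obtain ⟨f, ⟨U, hU, hsU, hf⟩, hfs⟩ := s.exists_extension
    refine ⟨f ∘ faceMap p i, ⟨faceMap p i ⁻¹' U,
      hU.preimage (contDiff_faceMap p i).continuous, fun x hx => hsU (faceMap_mem p i hx),
      hf.comp (contDiff_faceMap p i).contMDiff.contMDiffOn (fun x hx => hx)⟩, fun x => ?_⟩
    exact hfs ⟨faceMap p i x, faceMap_mem p i x.2⟩

/-- The smooth singular simplex `φ ∘ s`. -/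
def SmoothSimplex.map {p : ℕ} (φ : Diff n M) (s : SmoothSimplex n M p) : SmoothSimplex n M p where
  toFun x := φ (s.toFun x)
  exists_extension := by
    obtain ⟨f, ⟨U, hU, hsU, hf⟩, hfs⟩ := s.exists_extension
    exact ⟨φ ∘ f, ⟨U, hU, hsU, φ.contMDiff.comp_contMDiffOn hf⟩, fun x => congrArg φ (hfs x)⟩

variable (n M) in
/-- Integral smooth singular `p`-chains. -/
abbrev Chain (p : ℕ) : Type _ := SmoothSimplex n M p →₀ ℤ

/-- The boundary `∂ s = ∑ᵢ (-1)ⁱ (i-th face of s)`, extended additively. -/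
def boundary (p : ℕ) : Chain n M (p + 1) →+ Chain n M p :=
  Finsupp.liftAddHom fun s =>
    ∑ i : Fin (p + 2), ((-1) ^ (i : ℕ) : ℤ) • Finsupp.singleAddHom (s.face i)

/-- The integral `∫_s α` of a `p`-form over a smooth `p`-simplex. -/
def integralSimplex {p : ℕ} (α : ClosedForm n p M) (s : SmoothSimplex n M p) : ℝ :=
  ∫ x in openSimplex p, α.val (s.extension x) fun i =>
    mfderiv 𝓘(ℝ, Fin p → ℝ) 𝓘(ℝ, Model n) s.extension x (Pi.single i 1 : Fin p → ℝ)

/-- The integral `∫_c α` of a `p`-form over a chain. -/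
def integralChain {p : ℕ} (α : ClosedForm n p M) (c : Chain n M p) : ℝ :=
  c.sum fun s m => (m : ℝ) * integralSimplex α s

/-- A closed form of positive degree has integral periods if its integral over every smooth
singular cycle is an integer. -/
def HasIntegralPeriods {q : ℕ} (α : ClosedForm n (q + 1) M) : Prop :=
  ∀ c : Chain n M (q + 1), boundary q c = 0 → ∃ m : ℤ, integralChain α c = m

theorem simplex_subset_Icc (p : ℕ) : simplex p ⊆ Icc 0 1 := by
  intro x hx
  refine ⟨fun i => hx.1 i, fun i => ?_⟩
  exact (Finset.single_le_sum (fun j _ => hx.1 j) (Finset.mem_univ i)).trans hx.2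

theorem isCompact_simplex (p : ℕ) : IsCompact (simplex p) := by
  refine isCompact_Icc.of_isClosed_subset ?_ (simplex_subset_Icc p)
  refine IsClosed.inter (s₁ := {x : Fin p → ℝ | ∀ i, 0 ≤ x i}) ?_ ?_
  · simp only [ofPred_forall]
    exact isClosed_iInter fun i => isClosed_le continuous_const (continuous_apply i)
  · exact isClosed_le (continuous_finsetSum _ fun i _ => continuous_apply i) continuous_const

theorem openSimplex_subset (p : ℕ) : openSimplex p ⊆ simplex p :=
  fun _ hx => ⟨fun i => (hx.1 i).le, hx.2.le⟩

theorem isOpen_openSimplex (p : ℕ) : IsOpen (openSimplex p) := by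
  refine IsOpen.inter (s := {x : Fin p → ℝ | ∀ i, 0 < x i}) ?_ ?_
  · simp only [ofPred_forall]
    exact isOpen_iInter_of_finite fun i => isOpen_lt continuous_const (continuous_apply i)
  · exact isOpen_lt (continuous_finsetSum _ fun i _ => continuous_apply i) continuous_const

section
variable [IsManifold 𝓘(ℝ, Model n) ∞ M]

theorem continuousAt_integrand {p : ℕ} (α : ClosedForm n p M) {f : (Fin p → ℝ) → M}
    {x₀ : Fin p → ℝ} {U : Set (Fin p → ℝ)} (hU : IsOpen U) (hx₀ : x₀ ∈ U)
    (hf : ContMDiffOn 𝓘(ℝ, Fin p → ℝ) 𝓘(ℝ, Model n) ∞ f U) :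
    ContinuousAt (fun x => α.val (f x) fun i =>
      mfderiv 𝓘(ℝ, Fin p → ℝ) 𝓘(ℝ, Model n) f x (Pi.single i 1 : Fin p → ℝ)) x₀ := by
  set e := chartAt (Model n) (f x₀) with he_def
  have he : IsSmoothChart e := IsManifold.chart_mem_maximalAtlas _
  set V : Set (Fin p → ℝ) := U ∩ f ⁻¹' e.source with hV_def
  have hV : IsOpen V := hf.continuousOn.isOpen_inter_preimage hU e.open_source
  have hx₀V : x₀ ∈ V := ⟨hx₀, mem_chart_source _ _⟩
  have hF : ContDiffOn ℝ ∞ (e ∘ f) V := by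
    rw [← contMDiffOn_iff_contDiffOn]
    exact (contMDiffOn_of_mem_maximalAtlas he).comp (hf.mono inter_subset_left) fun x hx => hx.2
  have hcont : ContinuousAt (fun x => formInChart e α.val (e (f x)) fun i =>
      fderiv ℝ (e ∘ f) x (Pi.single i 1)) x₀ := by
    have h1 : ContinuousAt (fun x => formInChart e α.val (e (f x))) x₀ := by
      have a := ((α.property e he).1.continuousOn.continuousAt
        (e.open_target.mem_nhds (e.map_source hx₀V.2)))
      exact a.comp (f := e ∘ f) (hF.continuousOn.continuousAt (hV.mem_nhds hx₀V))
    have h2 : ContinuousAt (fderiv ℝ (e ∘ f)) x₀ :=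
      (hF.continuousOn_fderiv_of_isOpen hV (by simp)).continuousAt (hV.mem_nhds hx₀V)
    have h3 : ContinuousAt (fun x => fun i : Fin p => fderiv ℝ (e ∘ f) x (Pi.single i 1)) x₀ :=
      continuousAt_pi.2 fun i => h2.clm_apply continuousAt_const
    have h4 : ContinuousAt
        (fun x => (formInChart e α.val (e (f x))).toContinuousMultilinearMap) x₀ :=
      ContinuousAlternatingMap.continuous_toContinuousMultilinearMap.continuousAt.comp h1
    exact h4.eval h3
  refine hcont.congr ?_
  filter_upwards [hV.mem_nhds hx₀V] with x hx
  have hd : MDifferentiableAt 𝓘(ℝ, Fin p → ℝ) 𝓘(ℝ, Model n) (e ∘ f) x :=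
    ((hF.contDiffAt (hV.mem_nhds hx)).differentiableAt (by simp)).mdifferentiableAt
  have hs : MDifferentiableAt 𝓘(ℝ, Model n) 𝓘(ℝ, Model n) e.symm ((e ∘ f) x) :=
    (contMDiffAt_symm_of_mem_maximalAtlas he (e.map_source hx.2)).mdifferentiableAt (by simp)
  have hcomp := mfderiv_comp x hs hd
  have heq : e.symm ∘ e ∘ f =ᶠ[𝓝 x] f := by
    filter_upwards [hV.mem_nhds hx] with z hz
    exact e.left_inv hz.2
  rw [heq.mfderiv_eq, mfderiv_eq_fderiv] at hcomp
  have hpt : e.symm (e (f x)) = f x := e.left_inv hx.2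
  have : ∀ (z : M), z = f x → ∀ D : (Fin p → ℝ) →L[ℝ] Model n,
      (α.val z (fun i => D (Pi.single i 1)) : ℝ) = α.val (f x) (fun i => D (Pi.single i 1)) := by
    rintro _ rfl _; rfl
  rw [hcomp]
  exact this _ hpt ((mfderiv 𝓘(ℝ, Model n) 𝓘(ℝ, Model n) e.symm ((e ∘ f) x)).comp
    (fderiv ℝ (e ∘ f) x))

theorem SmoothSimplex.extension_spec {p : ℕ} (s : SmoothSimplex n M p) :
    IsSmoothExtension n s.toFun s.extension := s.exists_extension.choose_spec

theorem integrableOn_integrand {p : ℕ} (α : ClosedForm n p M) (s : SmoothSimplex n M p) :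
    IntegrableOn (fun x => α.val (s.extension x) fun i =>
      mfderiv 𝓘(ℝ, Fin p → ℝ) 𝓘(ℝ, Model n) s.extension x (Pi.single i 1 : Fin p → ℝ))
      (openSimplex p) := by
  obtain ⟨⟨U, hU, hsU, hf⟩, -⟩ := s.extension_spec
  refine IntegrableOn.mono_set ?_ (openSimplex_subset p)
  refine ContinuousOn.integrableOn_compact (isCompact_simplex p) fun x hx => ?_
  exact (continuousAt_integrand α hU (hsU hx) hf).continuousWithinAt

theorem integralSimplex_add {p : ℕ} (α β : ClosedForm n p M) (s : SmoothSimplex n M p) :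
    integralSimplex (α + β) s = integralSimplex α s + integralSimplex β s :=
  integral_add (integrableOn_integrand α s) (integrableOn_integrand β s)

theorem integralSimplex_zero {p : ℕ} (s : SmoothSimplex n M p) :
    integralSimplex (0 : ClosedForm n p M) s = 0 := by
  refine (integral_congr_ae (Filter.Eventually.of_forall fun x => ?_)).trans (integral_zero _ _)
  rfl

theorem integralSimplex_neg {p : ℕ} (α : ClosedForm n p M) (s : SmoothSimplex n M p) :
    integralSimplex (-α) s = -integralSimplex α s := by
  have := integralSimplex_add α (-α) s
  rw [add_neg_cancel, integralSimplex_zero] at this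
  linarith

theorem integralSimplex_pullback {p : ℕ} (φ : Diff n M) (α : ClosedForm n p M)
    (s : SmoothSimplex n M p) :
    integralSimplex (α.pullback φ) s = integralSimplex α (s.map φ) := by
  refine setIntegral_congr_fun (isOpen_openSimplex p).measurableSet fun x hx => ?_
  obtain ⟨⟨U, hU, hsU, hf⟩, h1⟩ := s.extension_spec
  obtain ⟨-, h2⟩ := (s.map φ).extension_spec
  have heq : (s.map φ).extension =ᶠ[𝓝 x] φ ∘ s.extension := by
    filter_upwards [(isOpen_openSimplex p).mem_nhds hx] with z hz
    rw [h2 ⟨z, openSimplex_subset p hz⟩, Function.comp_apply, h1 ⟨z, openSimplex_subset p hz⟩]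
    rfl
  have hxU : U ∈ 𝓝 x := hU.mem_nhds (hsU (openSimplex_subset p hx))
  have hD := mfderiv_comp (I := 𝓘(ℝ, Fin p → ℝ)) x
    (φ.mdifferentiable (by simp) (s.extension x))
    ((hf.contMDiffAt hxU).mdifferentiableAt (by simp))
  rw [← heq.mfderiv_eq] at hD
  have : ∀ (z : M), z = φ (s.extension x) → ∀ D : (Fin p → ℝ) →L[ℝ] Model n,
      α.val (φ (s.extension x)) (fun i => D (Pi.single i 1)) =
        (α.val z (fun i => D (Pi.single i 1)) : ℝ) := by
    rintro _ rfl _; rfl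
  simp only [hD]
  exact this _ heq.self_of_nhds ((mfderiv 𝓘(ℝ, Model n) 𝓘(ℝ, Model n) φ (s.extension x)).comp
    (mfderiv 𝓘(ℝ, Fin p → ℝ) 𝓘(ℝ, Model n) s.extension x))

/-- The chain `φ_* c`. -/
def mapChain {p : ℕ} (φ : Diff n M) : Chain n M p →+ Chain n M p :=
  Finsupp.mapDomain.addMonoidHom (SmoothSimplex.map φ)

theorem boundary_mapChain {q : ℕ} (φ : Diff n M) (c : Chain n M (q + 1)) :
    boundary q (mapChain φ c) = mapChain φ (boundary q c) := by
  have : (boundary q).comp (mapChain φ) = (mapChain φ).comp (boundary q) := by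
    ext s : 2
    simp [boundary, mapChain, SmoothSimplex.face, SmoothSimplex.map, map_sum]
  exact DFunLike.congr_fun this c

theorem integralChain_pullback {p : ℕ} (φ : Diff n M) (α : ClosedForm n p M) (c : Chain n M p) :
    integralChain (α.pullback φ) c = integralChain α (mapChain φ c) := by
  unfold integralChain mapChain
  simp only [integralSimplex_pullback]
  refine (Finsupp.sum_mapDomain_index (h := fun s (m : ℤ) => (m : ℝ) * integralSimplex α s)
    ?_ ?_).symm
  · simp
  · intros; push_cast; ring

variable (n M) in
/-- `Ω^{q+1}_ℤ(M)`: the group of closed `(q+1)`-forms with integral periods. -/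
def integralForms (q : ℕ) : AddSubgroup (ClosedForm n (q + 1) M) where
  carrier := {α | HasIntegralPeriods α}
  zero_mem' c _ := ⟨0, by simp [integralChain, integralSimplex_zero]⟩
  add_mem' {α β} hα hβ c hc := by
    obtain ⟨a, ha⟩ := hα c hc
    obtain ⟨b, hb⟩ := hβ c hc
    refine ⟨a + b, ?_⟩
    push_cast
    rw [← ha, ← hb]
    simp [integralChain, integralSimplex_add, mul_add, Finsupp.sum_add]
  neg_mem' {α} hα c hc := by
    obtain ⟨a, ha⟩ := hα c hc
    refine ⟨-a, ?_⟩
    push_cast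
    rw [← ha]
    simp [integralChain, integralSimplex_neg, Finsupp.sum_neg]

/-- The pullback of a form with integral periods along a diffeomorphism. -/
def integralPullback {q : ℕ} (φ : Diff n M) (α : integralForms n M q) : integralForms n M q :=
  ⟨(α : ClosedForm n (q + 1) M).pullback φ, fun c hc => by
    rw [integralChain_pullback]
    exact α.2 _ (by rw [boundary_mapChain, hc, map_zero])⟩

end
end Periods

/-! ### Background fields, local transformations and the quotient -/

section Quotient

variable (n q : ℕ) (M : Type*) [TopologicalSpace M] [ChartedSpace (Model n) M]
  [IsManifold 𝓘(ℝ, Model n) ∞ M]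

/-- The space `𝓑 = Ω^{q+1}_closed(M) × 𝓜` of background fields, with the product topology. -/
abbrev Background : Type _ := ClosedForm n (q + 1) M × Metric n M

/-- The group `𝓖` of local transformations acting on background fields: pairs `(B, φ)` of a closed
form `B` with integral periods and a diffeomorphism `φ` in the given group `Γ`. -/
@[ext] structure LocalTransformation (Γ : Subgroup (Diff n M)) where
  form : integralForms n M q
  diffeo : Γ

variable {n q M} {Γ : Subgroup (Diff n M)}

/-- The semidirect product law; `b * a` is the transformation `a` followed by `b`. -/
instance : Group (LocalTransformation n q M Γ) where
  mul b a := ⟨integralPullback (b.diffeo : Diff n M) a.form + b.form, a.diffeo * b.diffeo⟩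
  one := ⟨0, 1⟩
  inv a := ⟨-integralPullback ((a.diffeo⁻¹ : Γ) : Diff n M) a.form, a.diffeo⁻¹⟩
  mul_assoc c b a := by
    refine LocalTransformation.ext (Subtype.ext ?_) (mul_assoc _ _ _).symm
    change a.form.1.pullback ((b.diffeo : Diff n M) * (c.diffeo : Diff n M)) +
        (b.form.1.pullback (c.diffeo : Diff n M) + c.form.1) =
      (a.form.1.pullback (b.diffeo : Diff n M) + b.form.1).pullback (c.diffeo : Diff n M) + c.form.1
    rw [ClosedForm.pullback_mul, ClosedForm.pullback_add, add_assoc]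
  one_mul a := by
    refine LocalTransformation.ext (Subtype.ext ?_) (mul_one _)
    change a.form.1.pullback (1 : Diff n M) + 0 = a.form.1
    rw [ClosedForm.pullback_one, add_zero]
  mul_one a := by
    refine LocalTransformation.ext (Subtype.ext ?_) (one_mul _)
    change (0 : ClosedForm n (q + 1) M).pullback (a.diffeo : Diff n M) + a.form.1 = a.form.1
    exact zero_add _
  inv_mul_cancel a := by
    refine LocalTransformation.ext (Subtype.ext ?_) (mul_inv_cancel _)
    change a.form.1.pullback ((a.diffeo⁻¹ : Γ) : Diff n M) +
      -a.form.1.pullback ((a.diffeo⁻¹ : Γ) : Diff n M) = 0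
    exact add_neg_cancel _

/-- The action `(B, φ) · (A, g) = (φ^* A + B, φ^* g)` on background fields. -/
instance : MulAction (LocalTransformation n q M Γ) (Background n q M) where
  smul a x := (x.1.pullback (a.diffeo : Diff n M) + a.form, x.2.pullback (a.diffeo : Diff n M))
  one_smul x := by
    refine Prod.ext ?_ (Metric.pullback_one _)
    change x.1.pullback (1 : Diff n M) + 0 = x.1
    rw [ClosedForm.pullback_one, add_zero]
  mul_smul b a x := by
    refine Prod.ext ?_ (Metric.pullback_mul _ _ _)
    change x.1.pullback ((a.diffeo : Diff n M) * (b.diffeo : Diff n M)) +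
        (a.form.1.pullback (b.diffeo : Diff n M) + b.form.1) =
      (x.1.pullback (a.diffeo : Diff n M) + a.form.1).pullback (b.diffeo : Diff n M) + b.form.1
    rw [ClosedForm.pullback_mul, ClosedForm.pullback_add, add_assoc]

variable (q Γ) in
/-- The quotient `𝓕 = 𝓑 / 𝓖`, with the quotient topology. -/
abbrev FieldSpace : Type _ :=
  Quotient (MulAction.orbitRel (LocalTransformation n q M Γ) (Background n q M))

variable (q Γ) in
/-- The projection `𝓑 → 𝓕`. -/
def proj (b : Background n q M) : FieldSpace q Γ := Quotient.mk _ b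

/-- A map from the unit interval to `𝓕` lifts locally to `𝓑`: near every parameter value it is the
projection of a continuous family of background fields. -/
def LocallyLifts (c : unitInterval → FieldSpace q Γ) : Prop :=
  ∀ t, ∃ U ∈ 𝓝 t, ∃ p : unitInterval → Background n q M,
    ContinuousOn p U ∧ ∀ s ∈ U, proj q Γ (p s) = c s

/-- A loop in `𝓕` based at `x`: a continuous loop in the quotient which lifts locally to continuous
paths in `𝓑`. (The quotient is singular; paths in it are understood, like all geometric objects on
it, through `𝓑`.) -/
structure FieldLoop (x : FieldSpace q Γ) extends Path x x where
  locallyLifts : LocallyLifts toPath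

/-- `p` is a path in `𝓑` lifting the loop `c`, and `a ∈ 𝓖` carries its initial point to its final
point. -/
def IsLift {x : FieldSpace q Γ} (c : FieldLoop x) (p : C(unitInterval, Background n q M))
    (a : LocalTransformation n q M Γ) : Prop :=
  (∀ t, proj q Γ (p t) = c.toPath t) ∧ p 1 = a • p 0

/-- The loop `c` is horizontal: it lifts to `t ↦ (t φ^* A + (1 - t) A, p₂ t)`, where `p₂` is a path
of metrics with `p₂ 1 = φ^* (p₂ 0)`. -/
def IsHorizontal {x : FieldSpace q Γ} (c : FieldLoop x) : Prop :=
  ∃ (A : ClosedForm n (q + 1) M) (φ : Γ) (p₂ : C(unitInterval, Metric n M)),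
    p₂ 1 = (p₂ 0).pullback (φ : Diff n M) ∧
    ∀ t, c.toPath t = proj q Γ
      ((t : ℝ) • A.pullback (φ : Diff n M) + (1 - (t : ℝ)) • A, p₂ t)

/-- The loop `c` is vertical: it lifts to `t ↦ (p₁ t, g)` with a constant metric `g` and
`p₁ 1 = p₁ 0 + B`, where `B` has integral periods. -/
def IsVertical {x : FieldSpace q Γ} (c : FieldLoop x) : Prop :=
  ∃ (p₁ : C(unitInterval, ClosedForm n (q + 1) M)) (g : Metric n M) (B : integralForms n M q),
    p₁ 1 = p₁ 0 + B ∧ ∀ t, c.toPath t = proj q Γ (p₁ t, g)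

/-- The map `(s, t) ↦ ((1 - ρ) (s φ^* p₁(0) + (1 - s) p₁(0) + t B) + ρ p₁(s), p₂(s))` with
`ρ = log s / log t`, for a path `p = (p₁, p₂)` and `a = (B, φ)`. When `t = 0` or `t = 1`, the
conventions `log 0 = 0` and `y / 0 = 0` give `ρ = 0`. -/
def simplexMap (p : unitInterval → Background n q M) (a : LocalTransformation n q M Γ)
    (s t : unitInterval) : Background n q M :=
  let ρ : ℝ := Real.log s / Real.log t
  ((1 - ρ) • ((s : ℝ) • (p 0).1.pullback (a.diffeo : Diff n M) + (1 - (s : ℝ)) • (p 0).1 +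
      (t : ℝ) • (a.form : ClosedForm n (q + 1) M)) + ρ • (p s).1,
    (p s).2)

end Quotient
end BackgroundFields
end

open BackgroundFields

/-! The map `simplexMap` fills the triangle `t ≤ s` with background fields: its diagonal is the lift
`p`, the side `t = 0` interpolates linearly from `p₁(0)` to `φ^* p₁(0)`, and the side `s = 1` adds
`tB` at a constant metric. Its vertices are `p(0)`, `(0, φ) • p(0)` and `(B, φ) • p(0)`, all in one
orbit, so the two sides project to a horizontal and a vertical loop. Pushing the diagonal across the
triangle onto these sides, and then projecting, is the required homotopy
(`exists_homotopy_of_simplex`). The metric depends on `s` alone, so only forms are ever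
interpolated.

The delicate point is continuity. The weight `log s / log t` is continuous on the triangle except at
`(0,0)` and `(1,1)`, where it has no limit. It is bounded by 1, however, and the two interpolated
families agree at these corners, so the weight multiplies a difference that tends to zero
(`continuousOn_interpolation`). This requires addition and scalar multiplication of closed forms to
be continuous in the `C^∞` topology.

The lift exists because the group acts by homeomorphisms: successive local lifts meet in a common
orbit, so the later one can be translated to match the earlier one (`exists_lift_of_locally_lifts`).
Pullback is continuous because it amounts to a change of chart (`continuous_cInftyTopology`). -/

namespace BackgroundFields

/-! ### Vector operations in the `C^∞` topology -/

section General

variable {X W : Type*} [AddCommGroup X] [Module ℝ X] [NormedAddCommGroup W] [NormedSpace ℝ W]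
  {n : ℕ} {M : Type*} [TopologicalSpace M] [ChartedSpace (Model n) M]

/-- The `r`-th derivative on `K` of functions that are smooth around `K` and depend linearly on a
parameter, as a linear map. -/
noncomputable def jetOn {K : Set (Model n)} (f : X →ₗ[ℝ] Model n → W)
    (hf : ∀ x, ∀ y ∈ K, ContDiffAt ℝ ∞ (f x) y) (r : ℕ) :
    X →ₗ[ℝ] K → Model n [×r]→L[ℝ] W where
  toFun x y := iteratedFDeriv ℝ r (f x) (y : Model n)
  map_add' a b := funext fun y => by
    rw [map_add]
    exact iteratedFDeriv_add_apply ((hf a y y.2).of_le (by exact_mod_cast le_top))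
      ((hf b y y.2).of_le (by exact_mod_cast le_top))
  map_smul' c a := funext fun y => by
    rw [map_smul]
    exact iteratedFDeriv_const_smul_apply ((hf a y y.2).of_le (by exact_mod_cast le_top))

/-- The derivative is continuous on the compact set `K`, so its range is compact. Boundedness is
what scalar multiplication needs: under uniform convergence it can fail to be continuous on
unbounded functions. -/
theorem isVonNBounded_range_jetOn {K : Set (Model n)} (hK : IsCompact K)
    (f : X →ₗ[ℝ] Model n → W) (hf : ∀ x, ∀ y ∈ K, ContDiffAt ℝ ∞ (f x) y) (r : ℕ) (x : X) :
    Bornology.IsVonNBounded ℝ (range (jetOn f hf r x)) := by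
  have hc : Continuous (jetOn f hf r x) := by
    refine continuous_iff_continuousAt.2 fun y => ?_
    have h : ContDiffAt ℝ 0 (iteratedFDeriv ℝ r (f x)) (y : Model n) :=
      (hf x y y.2).iteratedFDeriv_right (by rw [zero_add]; exact_mod_cast le_top)
    exact h.continuousAt.comp (f := ((↑) : K → Model n)) continuousAt_subtype_val
  have := isCompact_iff_compactSpace.1 hK
  exact (isCompact_range hc).isVonNBounded ℝ

theorem continuousAdd_cInftyTopology
    (rep : OpenPartialHomeomorph M (Model n) → X →ₗ[ℝ] Model n → W)
    (hrep : ∀ e, IsSmoothChart e → ∀ x, ∀ y ∈ e.target, ContDiffAt ℝ ∞ (rep e x) y) :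
    @ContinuousAdd X (cInftyTopology fun e x => rep e x) _ := by
  refine continuousAdd_iInf fun e => continuousAdd_iInf fun he => continuousAdd_iInf fun K =>
    continuousAdd_iInf fun hK => continuousAdd_iInf fun r => ?_
  -- The identity homomorphism only moves the values from the function type to its synonym with the
  -- uniform topology.
  let L : X →+ UniformFun K (Model n [×r]→L[ℝ] W) :=
    (AddMonoidHom.id _ : (K → Model n [×r]→L[ℝ] W) →+ UniformFun K (Model n [×r]→L[ℝ] W)).comp
      (jetOn (rep e) (fun x y hy => hrep e he x y (hK.2 hy)) r).toAddMonoidHom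
  exact continuousAdd_induced L

theorem continuousSMul_cInftyTopology
    (rep : OpenPartialHomeomorph M (Model n) → X →ₗ[ℝ] Model n → W)
    (hrep : ∀ e, IsSmoothChart e → ∀ x, ∀ y ∈ e.target, ContDiffAt ℝ ∞ (rep e x) y) :
    @ContinuousSMul ℝ X _ _ (cInftyTopology fun e x => rep e x) := by
  refine continuousSMul_iInf fun e => continuousSMul_iInf fun he => continuousSMul_iInf fun K =>
    continuousSMul_iInf fun hK => continuousSMul_iInf fun r => ?_
  have h : ∀ x, ∀ y ∈ K, ContDiffAt ℝ ∞ (rep e x) y := fun x y hy => hrep e he x y (hK.2 hy)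
  let _ : TopologicalSpace X :=
    TopologicalSpace.induced (UniformFun.ofFun ∘ jetOn (rep e) h r) inferInstance
  have : ContinuousSMul ℝ X :=
    UniformFun.continuousSMul_induced_of_range_bounded ℝ K _ X (jetOn (rep e) h r) ⟨rfl⟩
      (isVonNBounded_range_jetOn hK.1 (rep e) h r)
  exact this

end General

/-! ### Continuity of the group action -/

section Topology

variable {n k : ℕ} {M : Type*} [TopologicalSpace M] [ChartedSpace (Model n) M]

theorem ClosedForm.contDiffAt {e : OpenPartialHomeomorph M (Model n)} (he : IsSmoothChart e)
    (α : ClosedForm n k M) {y : Model n} (hy : y ∈ e.target) :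
    ContDiffAt ℝ ∞ (formInChart e α.val) y :=
  (α.property e he).1.contDiffAt (e.open_target.mem_nhds hy)

/-- The coordinate expression of a closed form in a chart, as a linear map. -/
noncomputable def closedFormInChart (e : OpenPartialHomeomorph M (Model n)) :
    ClosedForm n k M →ₗ[ℝ] Model n → Model n [⋀^Fin k]→L[ℝ] ℝ where
  toFun α := formInChart e α.val
  map_add' _ _ := rfl
  map_smul' _ _ := rfl

instance : ContinuousAdd (ClosedForm n k M) :=
  continuousAdd_cInftyTopology closedFormInChart fun _ he α _ hy => α.contDiffAt he hy

instance : ContinuousSMul ℝ (ClosedForm n k M) :=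
  continuousSMul_cInftyTopology closedFormInChart fun _ he α _ hy => α.contDiffAt he hy

variable [IsManifold 𝓘(ℝ, Model n) ∞ M]

/-- A transformation of tensor fields that acts on coordinate expressions by pushing charts forward
along a diffeomorphism is continuous in the `C^∞` topology. -/
theorem continuous_cInftyTopology {X W : Type*} [NormedAddCommGroup W] [NormedSpace ℝ W]
    {rep : OpenPartialHomeomorph M (Model n) → X → Model n → W} (φ : Diff n M) {F : X → X}
    (hF : ∀ e, IsSmoothChart e → ∀ x, EqOn (rep e (F x)) (rep (pushChart φ e) x) e.target) :
    @Continuous X X (cInftyTopology rep) (cInftyTopology rep) F := by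
  refine continuous_iInf_rng.2 fun e => continuous_iInf_rng.2 fun he =>
    continuous_iInf_rng.2 fun K => continuous_iInf_rng.2 fun hK => continuous_iInf_rng.2 fun r =>
      continuous_induced_rng.2 ?_
  have h : (fun x => UniformFun.ofFun fun y : K => iteratedFDeriv ℝ r (rep e x) (y : Model n)) ∘ F
      = fun x => UniformFun.ofFun fun y : K =>
        iteratedFDeriv ℝ r (rep (pushChart φ e) x) (y : Model n) := by
    funext x
    -- The two expressions agree on the open set `e.target`, hence near each point of `K`, so their
    -- derivatives there agree too.
    refine congrArg UniformFun.ofFun (funext fun y => ?_)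
    exact (Filter.EventuallyEq.iteratedFDeriv ℝ ((hF e he x).eventuallyEq_of_mem
      (e.open_target.mem_nhds (hK.2 y.2))) r).self_of_nhds
  rw [h]
  -- The pushed chart has the same target, so the same `K` and `r` index a member of the family
  -- defining the topology on the source.
  refine continuous_iInf_dom (i := pushChart φ e) <| continuous_iInf_dom
    (i := isSmoothChart_pushChart φ he) <| continuous_iInf_dom (i := K) <| continuous_iInf_dom
    (i := ⟨hK.1, hK.2.trans (pushChart_target φ e).ge⟩) <| continuous_iInf_dom (i := r)
    continuous_induced_dom

theorem ClosedForm.continuous_pullback (φ : Diff n M) :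
    Continuous (ClosedForm.pullback (k := k) φ) :=
  continuous_cInftyTopology φ fun _ he α _ hy => formInChart_pullback φ he α.val hy

theorem metricInChart_pullback (φ : Diff n M) {e : OpenPartialHomeomorph M (Model n)}
    (he : IsSmoothChart e) (g : Metric n M) {y : Model n} (hy : y ∈ e.target) :
    metricInChart e (g.pullback φ) y = metricInChart (pushChart φ e) g y := by
  ext v w
  simp only [metricInChart, Metric.pullback, pushChart_symm_apply, mfderiv_pushChart_symm φ he hy]
  rfl

theorem Metric.continuous_pullback (φ : Diff n M) :
    Continuous (Metric.pullback φ : Metric n M → Metric n M) :=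
  continuous_cInftyTopology φ fun _ he g _ hy => metricInChart_pullback φ he g hy

instance {q : ℕ} {Γ : Subgroup (Diff n M)} :
    ContinuousConstSMul (LocalTransformation n q M Γ) (Background n q M) where
  continuous_const_smul a :=
    (((ClosedForm.continuous_pullback (a.diffeo : Diff n M)).comp continuous_fst).add
      continuous_const).prodMk
      ((Metric.continuous_pullback (a.diffeo : Diff n M)).comp continuous_snd)

end Topology

end BackgroundFields

/-! ### Lifting paths from an orbit space -/

section Lifting

/-- A map from the unit interval to an orbit space that locally lifts to continuous families lifts
to a continuous path. -/
theorem exists_lift_of_locally_lifts {G B : Type*} [Group G] [MulAction G B] [TopologicalSpace B]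
    [ContinuousConstSMul G B] (c : unitInterval → Quotient (MulAction.orbitRel G B))
    (hc : ∀ t, ∃ U ∈ 𝓝 t, ∃ p : unitInterval → B,
      ContinuousOn p U ∧ ∀ s ∈ U, Quotient.mk _ (p s) = c s) :
    ∃ p : C(unitInterval, B), ∀ t, Quotient.mk _ (p t) = c t := by
  choose U hU q hq hqc using hc
  -- Lebesgue subdivision: each interval `[t n, t (n + 1)]` lies in the domain of one local lift,
  -- and `t` is eventually 1.
  obtain ⟨t, ht0, htm, ⟨N, hN⟩, ht⟩ := exists_monotone_Icc_subset_open_cover_unitInterval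
    (c := fun i => interior (U i)) (fun _ => isOpen_interior)
    (fun x _ => mem_iUnion.2 ⟨x, mem_interior_iff_mem_nhds.2 (hU x)⟩)
  have key : ∀ n, ∃ p : unitInterval → B, ContinuousOn p (Icc 0 (t n)) ∧
      ∀ s ∈ Icc 0 (t n), Quotient.mk _ (p s) = c s := by
    intro n
    induction n with
    | zero =>
      refine ⟨q 0, ?_, ?_⟩
      · rw [ht0, Icc_self]
        exact continuousOn_singleton _ _
      · rw [ht0, Icc_self]
        rintro s rfl
        exact hqc 0 0 (mem_of_mem_nhds (hU 0))
    | succ n ih =>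
      obtain ⟨p, hp, hpc⟩ := ih
      obtain ⟨i, hi⟩ := ht n
      have hi' : Icc (t n) (t (n + 1)) ⊆ U i := hi.trans interior_subset
      have hle : t n ≤ t (n + 1) := htm n.le_succ
      -- Both lifts project to `c (t n)`, so some group element moves the next local lift onto the
      -- end of the lift built so far.
      obtain ⟨g, hg⟩ : ∃ g : G, g • q i (t n) = p (t n) := by
        refine MulAction.orbitRel_apply.1 (Quotient.exact ?_)
        rw [hpc _ ⟨unitInterval.nonneg', le_rfl⟩, hqc i _ (hi' ⟨le_rfl, hle⟩)]
      have h2 : EqOn (fun s => if s ≤ t n then p s else g • q i s) (fun s => g • q i s)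
          (Icc (t n) (t (n + 1))) := by
        intro s hs
        rcases hs.1.eq_or_lt with rfl | h
        · simp [hg]
        · simp [h]
      have h1 : EqOn (fun s => if s ≤ t n then p s else g • q i s) p (Icc 0 (t n)) :=
        fun s hs => if_pos hs.2
      have hun : Icc 0 (t n) ∪ Icc (t n) (t (n + 1)) = Icc 0 (t (n + 1)) :=
        Icc_union_Icc_eq_Icc unitInterval.nonneg' hle
      refine ⟨fun s => if s ≤ t n then p s else g • q i s, ?_, ?_⟩
      · rw [← hun]
        exact (hp.congr h1).union_of_isClosed ((((hq i).mono hi').const_smul g).congr h2)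
          isClosed_Icc isClosed_Icc
      · rw [← hun]
        rintro s (hs | hs)
        · rw [h1 hs, hpc s hs]
        · rw [h2 hs, ← hqc i s (hi' hs)]
          exact Quotient.sound (MulAction.orbitRel_apply.2 ⟨g, rfl⟩)
  obtain ⟨p, hp, hpc⟩ := key N
  rw [hN N le_rfl] at hp hpc
  have huniv : Icc (0 : unitInterval) 1 = univ :=
    eq_univ_of_forall fun s => ⟨unitInterval.nonneg', unitInterval.le_one'⟩
  rw [huniv] at hp hpc
  exact ⟨⟨p, continuousOn_univ.1 hp⟩, fun s => hpc s (mem_univ s)⟩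

end Lifting

/-! ### Interpolation with a logarithmic weight -/

section Simplex

/-- Balanced neighbourhoods of zero absorb scalars of norm at most 1, so the weights need not
converge and no norm on `E` is needed. -/
theorem tendsto_smul_zero_of_norm_le_one {E ι : Type*} [AddCommGroup E] [Module ℝ E]
    [TopologicalSpace E] [ContinuousSMul ℝ E] {l : Filter ι} {ρ : ι → ℝ} {d : ι → E}
    (hρ : ∀ᶠ x in l, ‖ρ x‖ ≤ 1) (hd : Filter.Tendsto d l (𝓝 0)) :
    Filter.Tendsto (fun x => ρ x • d x) l (𝓝 0) := by
  refine (nhds_basis_balanced ℝ E).tendsto_right_iff.2 fun V hV => ?_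
  filter_upwards [hρ, hd hV.1] with x h1 h2
  exact hV.2.smul_mem h1 h2

theorem continuousAt_inv_log {t : ℝ} (ht : t ≠ 1) (ht' : 0 ≤ t) :
    ContinuousAt (fun x => (Real.log x)⁻¹) t := by
  rcases ht'.eq_or_lt with rfl | h
  -- Since `log` tends to `-∞` at 0, its inverse tends to 0, which is exactly the default value of
  -- `(log 0)⁻¹`.
  · rw [← continuousWithinAt_compl_self, ContinuousWithinAt, Real.log_zero, inv_zero]
    exact tendsto_inv_atBot_zero.comp Real.tendsto_log_nhdsNE_zero
  · exact (Real.continuousAt_log h.ne').inv₀ (Real.log_ne_zero_of_pos_of_ne_one h ht)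

/-- On the triangle `log t ≤ log s ≤ 0` when `t > 0`; for `t = 0` the quotient is 0 by convention.
-/
theorem norm_log_div_log_le_one {s t : unitInterval} (h : t ≤ s) :
    ‖Real.log s / Real.log t‖ ≤ 1 := by
  rcases t.2.1.eq_or_lt with h0 | h0
  · simp [← h0]
  · have h1 : Real.log t ≤ Real.log s := Real.log_le_log h0 h
    have h2 : Real.log s ≤ 0 := Real.log_nonpos s.2.1 s.2.2
    rw [norm_div, Real.norm_of_nonpos h2, Real.norm_of_nonpos (h1.trans h2)]
    exact div_le_one_of_le₀ (neg_le_neg h1) (by linarith)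

theorem continuousWithinAt_interpolation_of_eq {X E : Type*} [TopologicalSpace X] [AddCommGroup E]
    [Module ℝ E] [TopologicalSpace E] [ContinuousAdd E] [ContinuousSMul ℝ E] {S : Set X} {x : X}
    {ρ : X → ℝ} {a b : X → E} (hρ : ∀ y ∈ S, ‖ρ y‖ ≤ 1) (ha : ContinuousWithinAt a S x)
    (hb : ContinuousWithinAt b S x) (hx : a x = b x) :
    ContinuousWithinAt (fun y => (1 - ρ y) • a y + ρ y • b y) S x := by
  -- The family is `a` plus a bounded multiple of the difference `b - a`, which vanishes at `x`. The
  -- difference is written with the scalar `-1` because only addition and scalar multiplication are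
  -- assumed continuous.
  have hform : (fun y => (1 - ρ y) • a y + ρ y • b y) =
      fun y => a y + ρ y • (b y + (-1 : ℝ) • a y) := by
    funext y
    module
  have hzero : b x + (-1 : ℝ) • a x = 0 := by rw [hx, neg_one_smul, add_neg_cancel]
  have hd : Filter.Tendsto (fun y => b y + (-1 : ℝ) • a y) (𝓝[S] x) (𝓝 0) := by
    rw [← hzero]
    exact hb.add (ha.const_smul (-1 : ℝ))
  have h := Filter.Tendsto.add ha (tendsto_smul_zero_of_norm_le_one
    (Filter.eventually_of_mem self_mem_nhdsWithin hρ) hd)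
  rw [hform, ContinuousWithinAt, hzero, smul_zero]
  exact h

/-- Interpolating with weight `log s / log t` between two continuous families on the simplex
`t ≤ s` that agree at the two corners gives a continuous family. -/
theorem continuousOn_interpolation {E : Type*} [AddCommGroup E] [Module ℝ E]
    [TopologicalSpace E] [ContinuousAdd E] [ContinuousSMul ℝ E]
    {a b : unitInterval × unitInterval → E} (ha : Continuous a) (hb : Continuous b)
    (h0 : a (0, 0) = b (0, 0)) (h1 : a (1, 1) = b (1, 1)) :
    ContinuousOn (fun z => (1 - Real.log z.1 / Real.log z.2) • a z +
      (Real.log z.1 / Real.log z.2) • b z) {z | z.2 ≤ z.1} := by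
  have corner := fun z => continuousWithinAt_interpolation_of_eq
    (S := {z : unitInterval × unitInterval | z.2 ≤ z.1}) (x := z)
    (ρ := fun z => Real.log z.1 / Real.log z.2) (fun w hw => norm_log_div_log_le_one hw)
    ha.continuousWithinAt hb.continuousWithinAt
  rintro ⟨s, t⟩ (hst : t ≤ s)
  by_cases hs : s = 0
  · obtain rfl : t = 0 := le_antisymm (hst.trans hs.le) unitInterval.nonneg'
    subst hs
    exact corner _ h0
  by_cases ht : t = 1
  · obtain rfl : s = 1 := le_antisymm unitInterval.le_one' (ht.ge.trans hst)
    subst ht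
    exact corner _ h1
  -- Away from the two corners `s ≠ 0` and `t ≠ 1`, so `log s` and `(log t)⁻¹` are both continuous,
  -- the latter even at `t = 0`.
  have hρ : ContinuousAt (fun z : unitInterval × unitInterval => Real.log z.1 / Real.log z.2)
      (s, t) := by
    simp only [div_eq_mul_inv]
    refine ContinuousAt.mul ?_ ?_
    · exact (Real.continuousAt_log (by simpa using hs)).comp
        (f := fun z : unitInterval × unitInterval => (z.1 : ℝ)) (by fun_prop)
    · exact (continuousAt_inv_log (t := (t : ℝ)) (by simpa using ht) t.2.1).comp
        (f := fun z : unitInterval × unitInterval => (z.2 : ℝ)) (x := (s, t)) (by fun_prop)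
  exact (((continuousAt_const.sub hρ).smul ha.continuousAt).add
    (hρ.smul hb.continuousAt)).continuousWithinAt

/-! ### Deforming the diagonal of the triangle -/

/-- The linear deformation, inside the simplex `t ≤ s`, of its diagonal to the path along its
two other sides. -/
theorem exists_simplex_deformation : ∃ σ τ : C(unitInterval × unitInterval, unitInterval),
    (∀ z, τ z ≤ σ z) ∧ (∀ t, σ (0, t) = t ∧ τ (0, t) = t) ∧
    (∀ r, σ (r, 0) = 0 ∧ τ (r, 0) = 0) ∧ (∀ r, σ (r, 1) = 1 ∧ τ (r, 1) = 1) ∧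
    (∀ t : unitInterval, (t : ℝ) ≤ 1 / 2 → (σ (1, t) : ℝ) = 2 * t ∧ τ (1, t) = 0) ∧
    (∀ t : unitInterval, 1 / 2 ≤ (t : ℝ) → σ (1, t) = 1 ∧ (τ (1, t) : ℝ) = 2 * t - 1) := by
  have hconv : ∀ (r : unitInterval) {u v : ℝ}, u ∈ Icc (0 : ℝ) 1 → v ∈ Icc (0 : ℝ) 1 →
      (1 - (r : ℝ)) * u + r * v ∈ Icc (0 : ℝ) 1 := fun r u v hu hv =>
    convex_Icc (0 : ℝ) 1 hu hv (by linarith [r.2.2]) r.2.1 (by ring)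
  -- At deformation time 1 the pair is `(min (2t) 1, max (2t - 1) 0)`: along `t = 0` and then up `s
  -- = 1`, each at the speed used by `Path.trans`.
  let σ : C(unitInterval × unitInterval, unitInterval) :=
    ⟨fun z => ⟨(1 - (z.1 : ℝ)) * z.2 + z.1 * min (2 * (z.2 : ℝ)) 1, hconv z.1 z.2.2
      ⟨le_min (by linarith [z.2.2.1]) zero_le_one, min_le_right _ _⟩⟩, by fun_prop⟩
  let τ : C(unitInterval × unitInterval, unitInterval) :=
    ⟨fun z => ⟨(1 - (z.1 : ℝ)) * z.2 + z.1 * max (2 * (z.2 : ℝ) - 1) 0, hconv z.1 z.2.2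
      ⟨le_max_right _ _, max_le (by linarith [z.2.2.2]) zero_le_one⟩⟩, by fun_prop⟩
  refine ⟨σ, τ, fun z => ?_, fun t => ⟨?_, ?_⟩, fun r => ⟨?_, ?_⟩, fun r => ⟨?_, ?_⟩,
    fun t ht => ⟨?_, ?_⟩, fun t ht => ⟨?_, ?_⟩⟩
  · refine Subtype.coe_le_coe.1 (add_le_add_right (mul_le_mul_of_nonneg_left ?_ z.1.2.1) _)
    have h0 := z.2.2.1
    have h1 := z.2.2.2
    exact max_le (le_min (by linarith) (by linarith)) (le_min (by linarith) zero_le_one)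
  · ext; simp [σ]
  · ext; simp [τ]
  · ext; simp [σ]
  · ext; simp [τ]
  · ext; simp [σ]
  · ext; norm_num [τ]
  · simp only [σ, ContinuousMap.coe_mk, Icc.coe_one]
    rw [min_eq_left (by linarith)]
    ring
  · ext
    simp only [τ, ContinuousMap.coe_mk, Icc.coe_one]
    rw [max_eq_right (by linarith)]
    simp
  · ext
    simp only [σ, ContinuousMap.coe_mk, Icc.coe_one]
    rw [min_eq_right (by linarith)]
    simp
  · simp only [τ, ContinuousMap.coe_mk, Icc.coe_one]
    rw [max_eq_left (by linarith)]
    ring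

/-- If a continuous family on the simplex `t ≤ s` projects to a path `γ` on the diagonal, then it
gives a homotopy from `γ` to the composition of its projections on the other two sides. -/
theorem exists_homotopy_of_simplex {B F : Type*} [TopologicalSpace B] [TopologicalSpace F]
    {π : B → F} (hπ : Continuous π) {P : unitInterval → unitInterval → B}
    (hP : ContinuousOn (fun z : unitInterval × unitInterval => P z.1 z.2) {z | z.2 ≤ z.1})
    {x y z : F} {γ : Path x z} {γ₁ : Path x y} {γ₂ : Path y z} (hγ : ∀ t, π (P t t) = γ t)
    (hγ₁ : ∀ s, π (P s 0) = γ₁ s) (hγ₂ : ∀ t, π (P 1 t) = γ₂ t) :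
    ∃ (H : γ.Homotopy (γ₁.trans γ₂)) (K : C(unitInterval × unitInterval, B)),
      (∀ z, π (K z) = H z) ∧ ∀ t, K (0, t) = P t t := by
  obtain ⟨σ, τ, hτσ, hl, hb0, hb1, hr0, hr1⟩ := exists_simplex_deformation
  let K : C(unitInterval × unitInterval, B) :=
    ⟨fun z => P (σ z) (τ z), hP.comp_continuous (σ.continuous.prodMk τ.continuous) hτσ⟩
  have hK : ∀ t, K (0, t) = P t t := fun t => by
    change P (σ (0, t)) (τ (0, t)) = P t t
    rw [(hl t).1, (hl t).2]
  have hright : ∀ t, π (K (1, t)) = γ₁.trans γ₂ t := by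
    intro t
    change π (P (σ (1, t)) (τ (1, t))) = _
    rw [Path.trans_apply]
    split_ifs with ht
    · rw [(hr0 t ht).2, hγ₁]
      exact congrArg γ₁ (Subtype.ext (hr0 t ht).1)
    · rw [(hr1 t (not_le.1 ht).le).1, hγ₂]
      exact congrArg γ₂ (Subtype.ext (hr1 t (not_le.1 ht).le).2)
  refine ⟨{ toFun := fun z => π (K z)
            continuous_toFun := hπ.comp K.continuous
            map_zero_left := fun t => by rw [hK, hγ]; rfl
            map_one_left := hright
            prop' := ?_ }, K, fun _ => rfl, hK⟩
  -- The endpoints are fixed because the deformation fixes the corners `(0,0)` and `(1,1)`.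
  rintro r t (rfl | rfl)
  · change π (P (σ (r, 0)) (τ (r, 0))) = γ 0
    rw [(hb0 r).1, (hb0 r).2, hγ]
  · change π (P (σ (r, 1)) (τ (r, 1))) = γ 1
    rw [(hb1 r).1, (hb1 r).2, hγ]

end Simplex

namespace BackgroundFields

/-! ### Horizontal and vertical loops -/

section Loops

variable {n q : ℕ} {M : Type*} [TopologicalSpace M] [ChartedSpace (Model n) M]
  [IsManifold 𝓘(ℝ, Model n) ∞ M] {Γ : Subgroup (Diff n M)} {x : FieldSpace q Γ}

theorem continuous_proj : Continuous (proj q Γ) := continuous_quotient_mk'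

theorem proj_smul (a : LocalTransformation n q M Γ) (b : Background n q M) :
    proj q Γ (a • b) = proj q Γ b :=
  Quotient.sound (MulAction.orbitRel_apply.2 ⟨a, rfl⟩)

theorem FieldLoop.exists_isLift (c : FieldLoop x) : ∃ p a, IsLift c p a := by
  obtain ⟨p, hp⟩ := exists_lift_of_locally_lifts c.toPath c.locallyLifts
  have h : proj q Γ (p 1) = proj q Γ (p 0) := by
    rw [proj, hp, proj, hp, c.toPath.target, c.toPath.source]
  obtain ⟨a, ha⟩ := MulAction.orbitRel_apply.1 (Quotient.exact h)
  exact ⟨p, a, hp, ha.symm⟩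

/-- The loop in `𝓕` that lifts to a given path in `𝓑`. -/
noncomputable def FieldLoop.ofLift (p : C(unitInterval, Background n q M))
    (h0 : proj q Γ (p 0) = x) (h1 : proj q Γ (p 1) = x) : FieldLoop x where
  toFun t := proj q Γ (p t)
  continuous_toFun := continuous_proj.comp p.continuous
  source' := h0
  target' := h1
  locallyLifts _ := ⟨univ, Filter.univ_mem, p, p.continuous.continuousOn, fun _ _ => rfl⟩

variable (p : C(unitInterval, Background n q M)) (a : LocalTransformation n q M Γ)

theorem simplexMap_zero (s : unitInterval) : simplexMap p a s 0 =
    ((s : ℝ) • (p 0).1.pullback (a.diffeo : Diff n M) + (1 - (s : ℝ)) • (p 0).1, (p s).2) := by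
  simp [simplexMap]

theorem simplexMap_one (t : unitInterval) : simplexMap p a 1 t =
    ((p 0).1.pullback (a.diffeo : Diff n M) +
      (t : ℝ) • (a.form : ClosedForm n (q + 1) M), (p 1).2) := by
  simp [simplexMap]

variable {p a}

theorem pullback_add_form (ha : p 1 = a • p 0) :
    (p 0).1.pullback (a.diffeo : Diff n M) + (a.form : ClosedForm n (q + 1) M) = (p 1).1 :=
  (congrArg Prod.fst ha).symm

/-- Inside the interval the weight is 1. At the ends it is 0 by convention, and the linear family
itself has the value `p₁`; at `t = 1` this is where `p 1 = a • p 0` enters. -/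
theorem simplexMap_self (ha : p 1 = a • p 0) (t : unitInterval) : simplexMap p a t t = p t := by
  rcases eq_or_ne t 0 with rfl | h0
  · rw [simplexMap_zero]
    simp
  rcases eq_or_ne t 1 with rfl | h1
  · rw [simplexMap_one, Icc.coe_one, one_smul, pullback_add_form ha]
  · have : Real.log t ≠ 0 := Real.log_ne_zero_of_pos_of_ne_one (unitInterval.pos_iff_ne_zero.2 h0)
      (by simpa using h1)
    simp [simplexMap, div_self this]

theorem continuousOn_simplexMap (ha : p 1 = a • p 0) :
    ContinuousOn (fun z : unitInterval × unitInterval => simplexMap p a z.1 z.2)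
      {z | z.2 ≤ z.1} := by
  refine ContinuousOn.prodMk (continuousOn_interpolation
    (a := fun z => (z.1 : ℝ) • (p 0).1.pullback (a.diffeo : Diff n M) + (1 - (z.1 : ℝ)) • (p 0).1 +
      (z.2 : ℝ) • (a.form : ClosedForm n (q + 1) M)) (b := fun z => (p z.1).1)
    (by fun_prop) (by fun_prop) ?_ ?_) (Continuous.continuousOn (by fun_prop))
  · simp
  · simp [pullback_add_form ha]

theorem FieldLoop.exists_homotopy {c : FieldLoop x} (h : IsLift c p a) :
    ∃ ch cv : FieldLoop x,
      IsHorizontal ch ∧ (∀ s, ch.toPath s = proj q Γ (simplexMap p a s 0)) ∧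
      IsVertical cv ∧ (∀ t, cv.toPath t = proj q Γ (simplexMap p a 1 t)) ∧
      ∃ (H : c.toPath.Homotopy (ch.toPath.trans cv.toPath))
        (K : C(unitInterval × unitInterval, Background n q M)),
        (∀ z, proj q Γ (K z) = H z) ∧ ∀ t, K (0, t) = p t := by
  obtain ⟨hp, ha⟩ := h
  have hcont := continuousOn_simplexMap ha
  have e0 : proj q Γ (simplexMap p a 0 0) = x := by
    rw [simplexMap_self ha, hp, c.toPath.source]
  have e1 : proj q Γ (simplexMap p a 1 1) = x := by
    rw [simplexMap_self ha, hp, c.toPath.target]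
  have e2 : proj q Γ (simplexMap p a 1 0) = x := by
    -- The third vertex is reached from `p 0` by the diffeomorphism alone, with zero form, so the
    -- two sides meet over the base point.
    have : simplexMap p a 1 0 = (⟨0, a.diffeo⟩ : LocalTransformation n q M Γ) • p 0 := by
      rw [simplexMap_one, ha, Icc.coe_zero, zero_smul]
      rfl
    rw [this, proj_smul, hp, c.toPath.source]
  let ph : C(unitInterval, Background n q M) := ⟨fun s => simplexMap p a s 0,
    hcont.comp_continuous (f := fun s => (s, 0)) (by fun_prop) fun _ => unitInterval.nonneg'⟩
  let pv : C(unitInterval, Background n q M) := ⟨fun t => simplexMap p a 1 t,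
    hcont.comp_continuous (f := fun t => (1, t)) (by fun_prop) fun _ => unitInterval.le_one'⟩
  have hph : ∀ s, (FieldLoop.ofLift ph e0 e2).toPath s = proj q Γ (simplexMap p a s 0) :=
    fun _ => rfl
  have hpv : ∀ t, (FieldLoop.ofLift pv e2 e1).toPath t = proj q Γ (simplexMap p a 1 t) :=
    fun _ => rfl
  refine ⟨FieldLoop.ofLift ph e0 e2, FieldLoop.ofLift pv e2 e1, ?_, hph, ?_, hpv, ?_⟩
  · exact ⟨(p 0).1, a.diffeo, ⟨fun s => (p s).2, by fun_prop⟩, congrArg Prod.snd ha,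
      fun t => by rw [hph, simplexMap_zero]; rfl⟩
  · refine ⟨⟨fun t => (pv t).1, by fun_prop⟩, (p 1).2, a.form, ?_, fun t => ?_⟩
    · change (simplexMap p a 1 1).1 = (simplexMap p a 1 0).1 + (a.form : ClosedForm n (q + 1) M)
      simp [simplexMap_one]
    · rw [hpv, simplexMap_one]
      change _ = proj q Γ ((simplexMap p a 1 t).1, (p 1).2)
      rw [simplexMap_one]
  · have hγ : ∀ t, proj q Γ (simplexMap p a t t) = c.toPath t := fun t => by
      rw [simplexMap_self ha, hp]
    obtain ⟨H, K, hK, hK0⟩ := exists_homotopy_of_simplex continuous_proj hcont hγ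
      (fun s => (hph s).symm) (fun t => (hpv t).symm)
    exact ⟨H, K, hK, fun t => (hK0 t).trans (simplexMap_self ha t)⟩

end Loops

end BackgroundFields

theorem mainTheorem8 (ℓ : ℕ) (M : Type*) [TopologicalSpace M] [T2Space M] [CompactSpace M]
    [ChartedSpace (Model (4 * ℓ + 2)) M] [IsManifold 𝓘(ℝ, Model (4 * ℓ + 2)) ∞ M]
    (Γ : Subgroup (Diff (4 * ℓ + 2) M))
    (x : FieldSpace (2 * ℓ) Γ) (c : FieldLoop x) :
    (∃ ch cv : FieldLoop x, IsHorizontal ch ∧ IsVertical cv ∧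
      c.toPath.Homotopic (ch.toPath.trans cv.toPath)) ∧
    (∃ p a, IsLift c p a) ∧
    (∀ p a, IsLift c p a →
      ContinuousOn (fun z : unitInterval × unitInterval => simplexMap p a z.1 z.2)
        {z | z.2 ≤ z.1} ∧
      (∀ t : unitInterval, simplexMap p a t t = p t) ∧
      (∀ s : unitInterval, simplexMap p a s 0 =
        ((s : ℝ) • (p 0).1.pullback (a.diffeo : Diff (4 * ℓ + 2) M) + (1 - (s : ℝ)) • (p 0).1,
          (p s).2)) ∧
      (∀ t : unitInterval, simplexMap p a 1 t =
        ((p 0).1.pullback (a.diffeo : Diff (4 * ℓ + 2) M) +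
          (t : ℝ) • (a.form : ClosedForm (4 * ℓ + 2) (2 * ℓ + 1) M), (p 1).2)) ∧
      ∃ ch cv : FieldLoop x,
        IsHorizontal ch ∧ (∀ s, ch.toPath s = proj (2 * ℓ) Γ (simplexMap p a s 0)) ∧
        IsVertical cv ∧ (∀ t, cv.toPath t = proj (2 * ℓ) Γ (simplexMap p a 1 t)) ∧
        ∃ (H : c.toPath.Homotopy (ch.toPath.trans cv.toPath))
          (K : C(unitInterval × unitInterval, Background (4 * ℓ + 2) (2 * ℓ) M)),
          (∀ z, proj (2 * ℓ) Γ (K z) = H z) ∧ ∀ t, K (0, t) = p t) := by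
  have main := fun p a (h : IsLift c p a) => FieldLoop.exists_homotopy h
  refine ⟨?_, c.exists_isLift, fun p a h => ⟨continuousOn_simplexMap h.2, simplexMap_self h.2,
    simplexMap_zero p a, simplexMap_one p a, main p a h⟩⟩
  obtain ⟨p, a, h⟩ := c.exists_isLift
  obtain ⟨ch, cv, hh, -, hv, -, H, -⟩ := main p a h
  exact ⟨ch, cv, hh, hv, ⟨H⟩⟩
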